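/- Let $P(s)$ and $Q(s)$ be polynomials with non-negative integer coefficients such that $P(0)=0$, $Q(0)=1$ and $Q\neq 1$. Define the real stabilization threshold $$\mathfrak{sth}_{\mathbb R}(P,Q;1):=\inf\{r\in\mathbb R \mid qP(t)<Q(t)^q \text{ for all real } q\ge r \text{ and all } t\ge 1\}\in[-\infty,\infty],$$ and let $r(s)$, for $s\ge 1$, be the largest real solution $\rho$ of $\rho P(s)=Q(s)^{\rho}$; put $r(s)=-\infty$ where there is no solution (that is, where $r$ is not defined), and let $\mathcal D\subseteq[1,\infty)$ be the set of $s\ge 1$ for which a solution exists. Then: - $\mathcal D=\{s\ge 1\mid P(s)\ge e\log Q(s)\}$, a largest solution exists for every $s\in\mathcal D$, and $\mathcal D$ is a finite disjoint union of closed intervals (one-point intervals and a closed half line being allowed). Let $s_1,\dots,s_k$ be the finite end points of these intervals. - The function $r$ has only finitely many critical points $c_1,\dots,c_m$, i.e. interior points of $\mathcal D$ at which $r$ is differentiable with $r'=0$. - The limit $\lim_{s\to\infty}r(s)$ exists in $[-\infty,\infty]$. If $P\ne 0$, then the last interval of $\mathcal D$ is a half line $[s_k,\infty)$ and the limit is a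 real number. - $$\mathfrak{sth}_{\mathbb R}(P,Q;1)=\max\{r(s_1),\dots,r(s_k),\,r(c_1),\dots,r(c_m),\,\lim_{s\to\infty}r(s)\}.$$ In particular, let $X$ be a simply connected rationally elliptic space, i.e. a simply connected space with $\dim\bigoplus_{k\ge2}\pi_k(X)\otimes\mathbb Q<\infty$ and $\dim\bigoplus_{k\ge0}H_k(X;\mathbb Q)<\infty$. Put $P^{\pi}_X(t)=\sum_{k\ge2}\dim(\pi_k(X)\otimes\mathbb Q)\,t^k$ and $P_X(t)=\sum_{k\ge0}\dim H_k(X;\mathbb Q)\,t^k$, and suppose that $P_X\ne 1$. Then all of the above holds for $P=P^{\pi}_X$ and $Q=P_X$; in particular, with $$\mathfrak{pp}_{\mathbb R}(X;1):=\inf\{r\in\mathbb R\mid qP^{\pi}_X(t)<P_X(t)^q \text{ for all real } q\ge r \text{ and all } t\ge 1\},$$ one has $$\mathfrak{pp}_{\mathbb R}(X;1)=\max\{r(s_1),\dots,r(s_k),\,r(c_1),\dots,r(c_m),\,\lim_{s\to\infty}r(s)\}.$$ -/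

import Mathlib

open Polynomial Filter Topology

universe u

namespace StabThreshold

noncomputable section

/-! ### The real stabilization threshold of two polynomials

Polynomials with non-negative integer coefficients are elements of `ℕ[X]`; `aeval t P` is the value
of `P` at the real number `t`. -/

/-- `inf {r ∈ ℝ | q P(t) < Q(t)^q for all real q ≥ r and all t ≥ ε}`, the infimum being taken in the
extended real numbers (so that it is `-∞` if all `r` qualify, and `+∞` if none does). -/
def sthReal (P Q : ℕ[X]) (ε : ℝ) : EReal :=
  sInf ((fun r : ℝ => (r : EReal)) ''
    {r : ℝ | ∀ q : ℝ, r ≤ q → ∀ t : ℝ, ε ≤ t → q * aeval t P < (aeval t Q : ℝ) ^ q})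

/-! ### The implicit function -/

/-- The real solutions `ρ` of the equation `ρ P(s) = Q(s)^ρ` for a fixed `s`. -/
def solutions (P Q : ℕ[X]) (s : ℝ) : Set ℝ :=
  {ρ : ℝ | ρ * aeval s P = (aeval s Q : ℝ) ^ ρ}

/-- The implicit function `r(s)`: the largest solution `ρ` of `ρ P(s) = Q(s)^ρ`. Where the equation
has no solution, i.e. where the implicit function is not defined, the value here is `⊥`. -/
def implicitFn (P Q : ℕ[X]) (s : ℝ) : EReal :=
  sSup ((fun ρ : ℝ => (ρ : EReal)) '' solutions P Q s)

/-- The domain of the implicit function: the `s ∈ [1, ∞)` for which `ρ P(s) = Q(s)^ρ` has a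
solution. -/
def implicitDomain (P Q : ℕ[X]) : Set ℝ :=
  {s : ℝ | 1 ≤ s ∧ (solutions P Q s).Nonempty}

/-- The critical points of the implicit function: the interior points of its domain at which it is
differentiable with derivative `0`. (On its domain the function is real valued.) -/
def criticalPoints (P Q : ℕ[X]) : Set ℝ :=
  {s : ℝ | s ∈ interior (implicitDomain P Q) ∧
    HasDerivAt (fun u : ℝ => (implicitFn P Q u).toReal) 0 s}

/-- `D` is the disjoint union of the closed intervals `[a i, b i]`, listed from left to right. A
right end `b i = ⊤` means the half line `[a i, ∞)`; because of `b i < a j` for `i < j`, only the last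
interval can be a half line. One-point intervals are allowed. -/
structure IsIntervalDecomposition (D : Set ℝ) {k : ℕ} (a : Fin k → ℝ) (b : Fin k → EReal) :
    Prop where
  le : ∀ i, (a i : EReal) ≤ b i
  lt : ∀ i j, i < j → b i < (a j : EReal)
  eq : D = ⋃ i, {s : ℝ | a i ≤ s ∧ (s : EReal) ≤ b i}

/-- The (finite) end points of the intervals `[a i, b i]`. -/
def endPoints {k : ℕ} (a : Fin k → ℝ) (b : Fin k → EReal) : Set ℝ :=
  {s : ℝ | ∃ i, s = a i ∨ (s : EReal) = b i}

/-- `τ` is the maximum of the values of the implicit function at the end points of its domain, of its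
values at its critical points, and of its limit at infinity. Included is all that this formula
presupposes: the domain is `{s ≥ 1 | P(s) ≥ e log Q(s)}` and is a finite disjoint union of closed
intervals, the function is real valued there, there are finitely many critical points, and the limit
exists; if `P ≠ 0`, the last interval is a half line and the limit is a real number. -/
structure MaxFormula (P Q : ℕ[X]) (τ : EReal) : Prop where
  domain_eq : implicitDomain P Q =
    {s : ℝ | 1 ≤ s ∧ Real.exp 1 * Real.log (aeval s Q) ≤ aeval s P}
  isGreatest_solution : ∀ s ∈ implicitDomain P Q,
    ∃ ρ : ℝ, IsGreatest (solutions P Q s) ρ ∧ implicitFn P Q s = ρ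
  finite_criticalPoints : (criticalPoints P Q).Finite
  formula : ∃ (k : ℕ) (a : Fin k → ℝ) (b : Fin k → EReal) (L : EReal),
    IsIntervalDecomposition (implicitDomain P Q) a b ∧
    Tendsto (implicitFn P Q) atTop (𝓝 L) ∧
    (P ≠ 0 → (∃ i, b i = ⊤) ∧ ∃ l : ℝ, L = l) ∧
    IsGreatest (implicitFn P Q '' endPoints a b ∪ implicitFn P Q '' criticalPoints P Q ∪ {L}) τ

/-! ### Rationally elliptic spaces and their Poincaré polynomials -/

/-- The rational singular homology `H_k(X; ℚ)`. -/
abbrev rationalHomology (X : Type u) [TopologicalSpace X] (k : ℕ) : ModuleCat.{u} ℚ :=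
  ((AlgebraicTopology.singularHomologyFunctor (ModuleCat.{u} ℚ) k).obj
    (ModuleCat.of ℚ (ULift.{u} ℚ))).obj (TopCat.of X)

/-- The rational homotopy group `π_k(X, x) ⊗ ℚ` in degree `k = i + 2`. -/
abbrev rationalHomotopy (X : Type u) [TopologicalSpace X] (x : X) (i : ℕ) : Type u :=
  TensorProduct ℤ ℚ (Additive (HomotopyGroup (Fin (i + 2)) X x))

/-- A rationally elliptic space (with base point `x`): a simply connected space for which the
rational vector spaces `⨁_{k ≥ 2} π_k(X) ⊗ ℚ` and `⨁_{k ≥ 0} H_k(X; ℚ)` are finite dimensional. -/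
structure IsRationallyElliptic (X : Type u) [TopologicalSpace X] (x : X) : Prop where
  simplyConnected : SimplyConnectedSpace X
  finite_homotopy : Module.Finite ℚ (DirectSum ℕ (fun i => rationalHomotopy X x i))
  finite_homology : Module.Finite ℚ (DirectSum ℕ (fun k => rationalHomology X k))

/-- The homological Poincaré polynomial `∑_{k ≥ 0} dim H_k(X; ℚ) t^k`. -/
def poincarePoly (X : Type u) [TopologicalSpace X] : ℕ[X] :=
  ∑ᶠ k : ℕ, monomial k (Module.finrank ℚ (rationalHomology X k))

/-- The homotopical Poincaré polynomial `∑_{k ≥ 2} dim (π_k(X) ⊗ ℚ) t^k`. -/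
def homotopyPoincarePoly (X : Type u) [TopologicalSpace X] (x : X) : ℕ[X] :=
  ∑ᶠ i : ℕ, monomial (i + 2) (Module.finrank ℚ (rationalHomotopy X x i))

/-- The real stabilization threshold of a rationally elliptic space:
`inf {r ∈ ℝ | q P^π_X(t) < P_X(t)^q for all real q ≥ r and all t ≥ ε}`. -/
def ppReal (X : Type u) [TopologicalSpace X] (x : X) (ε : ℝ) : EReal :=
  sthReal (homotopyPoincarePoly X x) (poincarePoly X) ε

end

end StabThreshold

namespace StabThreshold

/-! Fix `s ≥ 1` and put `p = P(s)`, `l = log Q(s) > 0`. For `p > 0` the equation reads `exp (l ρ) /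
ρ = p` with `ρ > 0`; the left side is minimal at `ρ = 1 / l` with value `e l` and increases
afterwards. So solutions exist iff `p ≥ e l`, the largest one is the solution with `l ρ ≥ 1`, and
the strict inequality holds beyond it. Hence `c` is admissible at `s` iff `r(s) < c`
(`forall_mul_lt_rpow_iff`), and the threshold is the supremum of `r` over `[1, ∞)`
(`sthReal_eq_iSup`).

Let `P ≠ 0`. Then `r` is upper semicontinuous on `[1, ∞)` and tends to `deg P / deg Q`, as comparing
logarithms with `log s` shows. So its supremum is this limit or is attained at some point of the
domain. If that point is interior, then `l ρ > 1` there, the implicit function is differentiable by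
inversion of `x - log x`, and the point is critical (`mem_criticalPoints_of_isMaxOn`).

Finiteness comes from Rolle's theorem: frontier points other than `1` are zeros of `P - e log Q`,
critical points are zeros of an expression in `P`, `Q` and their logarithms, and after one or two
differentiations only nonzero polynomials remain. For `P = 0` the domain is empty and everything is
`⊥`. For elliptic spaces only the two constant coefficients have to be computed. -/

/-! ### Comparison of a line with an exponential function -/

lemma exp_one_mul_le_exp (x : ℝ) : Real.exp 1 * x ≤ Real.exp x := by
  have h := Real.add_one_le_exp (x - 1)
  have h2 : Real.exp x = Real.exp 1 * Real.exp (x - 1) := by rw [← Real.exp_add]; ring_nf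
  rw [h2]
  have := Real.exp_pos 1
  gcongr
  linarith

/-- From `ρ` to `q` the line grows by at most the factor `1 + (q - ρ) l`, because `l ρ ≥ 1`, whereas
the exponential grows by the strictly larger factor `exp ((q - ρ) l)`. -/
lemma mul_lt_exp_of_lt {p l ρ q : ℝ} (hp : 0 < p) (hl : 0 < l) (h1 : 1 ≤ l * ρ)
    (h : ρ * p ≤ Real.exp (l * ρ)) (hq : ρ < q) : q * p < Real.exp (l * q) := by
  have hρ : 0 < ρ := by
    by_contra! hc
    nlinarith
  have hd : 0 < (q - ρ) * l := mul_pos (sub_pos.2 hq) hl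
  have h2 : Real.exp (l * q) = Real.exp (l * ρ) * Real.exp ((q - ρ) * l) := by
    rw [← Real.exp_add]; ring_nf
  have h3 := Real.add_one_lt_exp hd.ne'
  calc q * p = ρ * p + (q - ρ) * p * 1 := by ring
    _ ≤ ρ * p + (q - ρ) * p * (l * ρ) := by
        have : 0 ≤ (q - ρ) * p := (mul_pos (sub_pos.2 hq) hp).le
        gcongr
    _ = ρ * p * ((q - ρ) * l + 1) := by ring
    _ ≤ Real.exp (l * ρ) * ((q - ρ) * l + 1) := by gcongr
    _ < Real.exp (l * q) := by rw [h2]; gcongr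

lemma exists_mul_eq_exp {p l a : ℝ} (hl : 0 < l) (ha : 0 < a)
    (h : Real.exp (l * a) ≤ a * p) : ∃ ρ, a ≤ ρ ∧ ρ * p = Real.exp (l * ρ) := by
  -- From `2 p / l ^ 2` on, the quadratic term `(l b) ^ 2 / 2` of the exponential series already
  -- dominates `b p`.
  set b := max a (2 * p / l ^ 2) with hb
  have hab : a ≤ b := le_max_left _ _
  have hb0 : 0 < b := ha.trans_le hab
  have hbp : b * p ≤ Real.exp (l * b) := by
    have h1 := Real.quadratic_le_exp_of_nonneg (mul_pos hl hb0).le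
    have h2 : 2 * p ≤ b * l ^ 2 := by
      have := le_max_right a (2 * p / l ^ 2)
      rwa [div_le_iff₀ (by positivity)] at this
    have h3 : 0 < l * b := mul_pos hl hb0
    nlinarith
  have hc : ContinuousOn (fun x => Real.exp (l * x) - x * p) (Set.Icc a b) := by fun_prop
  obtain ⟨ρ, hρ, h0⟩ := intermediate_value_Icc hab hc
    (show (0 : ℝ) ∈ Set.Icc _ _ from ⟨by simpa using h, by simpa using hbp⟩)
  exact ⟨ρ, hρ.1, by simp only at h0; linarith⟩

lemma mul_lt_exp_of_lt_exp_one_mul {p l : ℝ} (hp : 0 < p) (h : p < Real.exp 1 * l) (q : ℝ) :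
    q * p < Real.exp (l * q) := by
  rcases le_or_gt q 0 with hq | hq
  · exact (mul_nonpos_of_nonpos_of_nonneg hq hp.le).trans_lt (Real.exp_pos _)
  · calc q * p < q * (Real.exp 1 * l) := by gcongr
      _ = Real.exp 1 * (l * q) := by ring
      _ ≤ _ := exp_one_mul_le_exp _

/-- The search starts at the minimum point `1 / l` of `exp (l q) / q`, so the solution found lies on
the increasing branch; this is what makes it the largest one. -/
lemma exists_mul_eq_exp_of_exp_one_mul_le {p l : ℝ} (hl : 0 < l) (h : Real.exp 1 * l ≤ p) :
    ∃ ρ, 1 ≤ l * ρ ∧ ρ * p = Real.exp (l * ρ) := by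
  obtain ⟨ρ, h1, h2⟩ := exists_mul_eq_exp (p := p) hl (inv_pos.2 hl) (by
    rw [mul_inv_cancel₀ hl.ne', inv_mul_eq_div, le_div_iff₀ hl]; exact h)
  refine ⟨ρ, ?_, h2⟩
  calc 1 = l * l⁻¹ := (mul_inv_cancel₀ hl.ne').symm
    _ ≤ l * ρ := by gcongr

/-! ### Values of polynomials with non-negative coefficients -/

lemma aeval_eq_eval_map (P : ℕ[X]) (s : ℝ) :
    (aeval s P : ℝ) = (P.map (Nat.castRingHom ℝ)).eval s := by
  rw [aeval_def, eval₂_eq_eval_map]; rfl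

lemma aeval_nonneg (P : ℕ[X]) {s : ℝ} (hs : 0 ≤ s) : 0 ≤ (aeval s P : ℝ) := by
  rw [aeval_eq_sum_range]
  exact Finset.sum_nonneg fun i _ => by positivity

lemma aeval_pos {P : ℕ[X]} (hP : P ≠ 0) {s : ℝ} (hs : 0 < s) : 0 < (aeval s P : ℝ) := by
  rw [aeval_eq_sum_range]
  refine Finset.sum_pos' (fun i _ => by positivity) ⟨P.natDegree, by simp, ?_⟩
  have : 0 < P.coeff P.natDegree := Nat.pos_of_ne_zero (by simpa using hP)
  positivity

lemma aeval_eq_one_add {Q : ℕ[X]} (h : Q.coeff 0 = 1) (s : ℝ) :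
    (aeval s Q : ℝ) = 1 + s * aeval s Q.divX := by
  conv_lhs => rw [← divX_mul_X_add Q]
  simp [h]
  ring

lemma divX_ne_zero_of_coeff_zero {Q : ℕ[X]} (h : Q.coeff 0 = 1) (h1 : Q ≠ 1) : Q.divX ≠ 0 := by
  intro h0
  apply h1
  rw [← divX_mul_X_add Q, h0, h]; simp

lemma one_lt_aeval {Q : ℕ[X]} (h : Q.coeff 0 = 1) (h1 : Q ≠ 1) {s : ℝ} (hs : 0 < s) :
    1 < (aeval s Q : ℝ) := by
  rw [aeval_eq_one_add h]
  have := mul_pos hs (aeval_pos (divX_ne_zero_of_coeff_zero h h1) hs)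
  linarith

lemma derivative_ne_zero_of_coeff_zero {Q : ℕ[X]} (h : Q.coeff 0 = 1) (h1 : Q ≠ 1) :
    derivative Q ≠ 0 := by
  intro h0
  rw [eq_C_of_natDegree_eq_zero (derivative_eq_zero.1 h0), h] at h1
  simp at h1

lemma derivative_ne_zero_of_coeff_zero_eq_zero {P : ℕ[X]} (h : P.coeff 0 = 0) (h1 : P ≠ 0) :
    derivative P ≠ 0 := by
  intro h0
  rw [eq_C_of_natDegree_eq_zero (derivative_eq_zero.1 h0), h] at h1
  simp at h1

/-! ### The implicit function -/

section

variable {P Q : ℕ[X]} {s : ℝ}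

lemma solutions_eq (hQ : 1 < (aeval s Q : ℝ)) :
    solutions P Q s =
      {ρ : ℝ | ρ * aeval s P = Real.exp (Real.log (aeval s Q) * ρ)} := by
  ext ρ
  rw [solutions, Set.mem_ofPred_eq, Set.mem_ofPred_eq, Real.rpow_def_of_pos (by linarith)]

lemma isGreatest_solutions (hP : 0 < (aeval s P : ℝ)) (hQ : 1 < (aeval s Q : ℝ)) {ρ : ℝ}
    (h1 : 1 ≤ Real.log (aeval s Q) * ρ) (hρ : ρ ∈ solutions P Q s) :
    IsGreatest (solutions P Q s) ρ := by
  refine ⟨hρ, fun q hq => ?_⟩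
  rw [solutions_eq hQ] at hρ hq
  by_contra! hlt
  exact (mul_lt_exp_of_lt hP (Real.log_pos hQ) h1 hρ.le hlt).ne hq

lemma implicitFn_eq_of_isGreatest {ρ : ℝ} (h : IsGreatest (solutions P Q s) ρ) :
    implicitFn P Q s = ρ := by
  apply IsGreatest.csSup_eq
  refine ⟨⟨ρ, h.1, rfl⟩, ?_⟩
  rintro _ ⟨q, hq, rfl⟩
  exact EReal.coe_le_coe_iff.2 (h.2 hq)

lemma solutions_nonempty_iff (hP : 0 < (aeval s P : ℝ)) (hQ : 1 < (aeval s Q : ℝ)) :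
    (solutions P Q s).Nonempty ↔ Real.exp 1 * Real.log (aeval s Q) ≤ aeval s P := by
  refine ⟨fun ⟨ρ, hρ⟩ => ?_, fun h => ?_⟩
  · rw [solutions_eq hQ] at hρ
    by_contra! hlt
    exact (mul_lt_exp_of_lt_exp_one_mul hP hlt ρ).ne hρ
  · obtain ⟨ρ, -, h2⟩ := exists_mul_eq_exp_of_exp_one_mul_le (Real.log_pos hQ) h
    exact ⟨ρ, by rw [solutions_eq hQ]; exact h2⟩

lemma exists_isGreatest_solutions (hP : 0 < (aeval s P : ℝ)) (hQ : 1 < (aeval s Q : ℝ))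
    (h : (solutions P Q s).Nonempty) :
    ∃ ρ : ℝ, 1 ≤ Real.log (aeval s Q) * ρ ∧ IsGreatest (solutions P Q s) ρ := by
  obtain ⟨ρ, h1, h2⟩ := exists_mul_eq_exp_of_exp_one_mul_le (Real.log_pos hQ)
    ((solutions_nonempty_iff hP hQ).1 h)
  exact ⟨ρ, h1, isGreatest_solutions hP hQ h1 (by rw [solutions_eq hQ]; exact h2)⟩

lemma implicitFn_eq_bot (h : ¬ (solutions P Q s).Nonempty) : implicitFn P Q s = ⊥ := by
  rw [Set.not_nonempty_iff_eq_empty] at h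
  simp [implicitFn, h]

lemma mul_lt_rpow_of_implicitFn_lt (hP : 0 ≤ (aeval s P : ℝ)) (hQ : 1 < (aeval s Q : ℝ)) {q : ℝ}
    (h : implicitFn P Q s < q) : q * aeval s P < (aeval s Q : ℝ) ^ q := by
  rw [Real.rpow_def_of_pos (by linarith)]
  rcases hP.eq_or_lt with hP | hP
  · rw [← hP, mul_zero]; exact Real.exp_pos _
  by_cases hne : (solutions P Q s).Nonempty
  · obtain ⟨ρ, h1, hρ⟩ := exists_isGreatest_solutions hP hQ hne
    rw [implicitFn_eq_of_isGreatest hρ, EReal.coe_lt_coe_iff] at h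
    have := hρ.1
    rw [solutions_eq hQ] at this
    exact mul_lt_exp_of_lt hP (Real.log_pos hQ) h1 this.le h
  · rw [solutions_nonempty_iff hP hQ, not_le] at hne
    exact mul_lt_exp_of_lt_exp_one_mul hP hne q

lemma lt_implicitFn_of_rpow_lt (hP : 0 ≤ (aeval s P : ℝ)) (hQ : 1 < (aeval s Q : ℝ)) {q : ℝ}
    (h : (aeval s Q : ℝ) ^ q < q * aeval s P) : (q : EReal) < implicitFn P Q s := by
  have h1 : (q : EReal) ≤ implicitFn P Q s := by
    by_contra! hc
    exact (mul_lt_rpow_of_implicitFn_lt hP hQ hc).not_gt h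
  refine h1.lt_of_ne fun he => ?_
  have hne : (solutions P Q s).Nonempty := by
    by_contra hne
    rw [implicitFn_eq_bot hne] at he
    exact EReal.coe_ne_bot _ he
  rcases hP.eq_or_lt with hP | hP
  · rw [← hP, mul_zero] at h
    exact (Real.rpow_pos_of_pos (by linarith) q).not_gt h
  obtain ⟨ρ, h1, hρ⟩ := exists_isGreatest_solutions hP hQ hne
  rw [implicitFn_eq_of_isGreatest hρ, EReal.coe_eq_coe_iff] at he
  have := hρ.1
  rw [solutions, Set.mem_ofPred_eq, ← he] at this
  linarith

/-- A value `q` to the right of the minimum of `exp (l q) / q` at which the inequality holds bounds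
the implicit function. -/
lemma implicitFn_lt_of_mul_lt_rpow (hP : 0 < (aeval s P : ℝ)) (hQ : 1 < (aeval s Q : ℝ)) {q : ℝ}
    (h1 : 1 ≤ Real.log (aeval s Q) * q)
    (h : q * aeval s P < (aeval s Q : ℝ) ^ q) : implicitFn P Q s < q := by
  by_cases hne : (solutions P Q s).Nonempty
  · obtain ⟨ρ, h1', hρ⟩ := exists_isGreatest_solutions hP hQ hne
    rw [implicitFn_eq_of_isGreatest hρ, EReal.coe_lt_coe_iff]
    have hρ' := hρ.1
    by_contra! hc
    rcases hc.eq_or_lt with rfl | hc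
    · rw [solutions, Set.mem_ofPred_eq] at hρ'; linarith
    · rw [solutions_eq hQ] at hρ'
      rw [Real.rpow_def_of_pos (by linarith)] at h
      exact (mul_lt_exp_of_lt hP (Real.log_pos hQ) h1 h.le hc).ne hρ'
  · rw [implicitFn_eq_bot hne]; exact EReal.bot_lt_coe _

/-- The strict inequality holds everywhere beyond the largest solution and fails at it. The value
`⊥` of the implicit function makes the equivalence correct where there is no solution. -/
lemma forall_mul_lt_rpow_iff (hP : 0 ≤ (aeval s P : ℝ)) (hQ : 1 < (aeval s Q : ℝ)) {c : ℝ} :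
    (∀ q : ℝ, c ≤ q → q * aeval s P < (aeval s Q : ℝ) ^ q) ↔ implicitFn P Q s < c := by
  refine ⟨fun h => ?_, fun h q hq =>
    mul_lt_rpow_of_implicitFn_lt hP hQ (h.trans_le (EReal.coe_le_coe_iff.2 hq))⟩
  by_contra! hc
  by_cases hne : (solutions P Q s).Nonempty
  · rcases hP.eq_or_lt with hP | hP
    · obtain ⟨ρ, hρ⟩ := hne
      rw [solutions, Set.mem_ofPred_eq, ← hP, mul_zero] at hρ
      exact (Real.rpow_pos_of_pos (by linarith) ρ).ne hρ
    obtain ⟨ρ, h1, hρ⟩ := exists_isGreatest_solutions hP hQ hne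
    rw [implicitFn_eq_of_isGreatest hρ, EReal.coe_le_coe_iff] at hc
    exact (h ρ hc).ne hρ.1
  · rw [implicitFn_eq_bot hne] at hc
    exact (EReal.bot_lt_coe c).not_ge hc

end

/-! ### The threshold as a supremum of the implicit function -/

lemma sInf_coe_setOf_forall_lt {ι : Type*} (f : ι → EReal) (A : Set ι) :
    sInf ((fun r : ℝ => (r : EReal)) '' {r : ℝ | ∀ i ∈ A, f i < r}) = ⨆ i ∈ A, f i := by
  apply le_antisymm
  · refine EReal.le_of_forall_lt_iff_le.1 fun z hz => ?_
    exact sInf_le ⟨z, fun i hi => (le_iSup₂ (f := fun i _ => f i) i hi).trans_lt hz, rfl⟩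
  · refine le_sInf ?_
    rintro _ ⟨r, hr, rfl⟩
    exact iSup₂_le fun i hi => (hr i hi).le

lemma sthReal_eq_iSup {P Q : ℕ[X]} (hQ0 : Q.coeff 0 = 1) (hQ1 : Q ≠ 1) {ε : ℝ} (hε : 0 < ε) :
    sthReal P Q ε = ⨆ s ∈ Set.Ici ε, implicitFn P Q s := by
  rw [← sInf_coe_setOf_forall_lt, sthReal]
  congr 2
  ext r
  simp only [Set.mem_ofPred_eq, Set.mem_Ici]
  constructor
  · intro h s hs
    exact (forall_mul_lt_rpow_iff (aeval_nonneg P (hε.le.trans hs))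
      (one_lt_aeval hQ0 hQ1 (hε.trans_le hs))).1 fun q hq => h q hq s hs
  · intro h q hq s hs
    exact (forall_mul_lt_rpow_iff (aeval_nonneg P (hε.le.trans hs))
      (one_lt_aeval hQ0 hQ1 (hε.trans_le hs))).2 (h s hs) q hq

/-! ### Decomposition of a closed set of real numbers into intervals -/

lemma inter_frontier_nonempty_of_isPreconnected {α : Type*} [TopologicalSpace α] {s t : Set α}
    (ht : IsPreconnected t) (h1 : (t ∩ s).Nonempty) (h2 : (t ∩ sᶜ).Nonempty) :
    (t ∩ frontier s).Nonempty := by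
  by_contra hc
  have hsub : t ⊆ interior s ∪ interior sᶜ := by
    rw [← compl_frontier_eq_union_interior]
    exact fun x hx hf => hc ⟨x, hx, hf⟩
  obtain ⟨x, hx, hxs⟩ := h1
  obtain ⟨y, hy, hys⟩ := h2
  obtain ⟨z, -, hz1, hz2⟩ := ht _ _ isOpen_interior isOpen_interior hsub
    ⟨x, hx, (hsub hx).resolve_right fun h => interior_subset h hxs⟩
    ⟨y, hy, (hsub hy).resolve_left fun h => hys (interior_subset h)⟩
  exact interior_subset hz2 (interior_subset hz1)

/-- Induction on the number of frontier points: splitting off the leftmost component `[a, b]`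
removes at least the frontier point `a`. -/
lemma exists_isIntervalDecomposition_of_ncard_le (n : ℕ) : ∀ D : Set ℝ, IsClosed D → BddBelow D →
    (frontier D).Finite → (frontier D).ncard ≤ n →
    ∃ (k : ℕ) (a : Fin k → ℝ) (b : Fin k → EReal), IsIntervalDecomposition D a b := by
  induction n with
  | zero =>
    intro D hD hb hf hn
    have h0 : frontier D = ∅ := by
      rwa [Nat.le_zero, Set.ncard_eq_zero hf] at hn
    rcases frontier_eq_empty_iff.1 h0 with rfl | rfl
    · exact ⟨0, Fin.elim0, Fin.elim0, fun i => i.elim0, fun i => i.elim0, by simp⟩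
    · exact absurd hb not_bddBelow_univ
  | succ n ih =>
    intro D hD hb hf hn
    rcases D.eq_empty_or_nonempty with rfl | hne
    · exact ⟨0, Fin.elim0, Fin.elim0, fun i => i.elim0, fun i => i.elim0, by simp⟩
    set a := sInf D with ha
    have haD : a ∈ D := hD.csInf_mem hne hb
    have hlow : ∀ x ∈ D, a ≤ x := fun x hx => csInf_le hb hx
    have haf : a ∈ frontier D := by
      refine ⟨subset_closure haD, fun hi => ?_⟩
      obtain ⟨x, hx, hxa⟩ := nonempty_of_mem (inter_mem
        (nhdsWithin_le_nhds (s := Set.Iio a) (mem_interior_iff_mem_nhds.1 hi)) self_mem_nhdsWithin)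
      exact (hlow x hx).not_gt hxa
    by_cases hall : Set.Ici a ⊆ D
    · refine ⟨1, fun _ => a, fun _ => ⊤, fun _ => le_top, fun i j hij => ?_, ?_⟩
      · exact absurd hij (by simp [Subsingleton.elim i j])
      · ext x
        simp only [Set.mem_iUnion, Set.mem_ofPred_eq, le_top, and_true, exists_const]
        exact ⟨hlow x, fun h => hall h⟩
    obtain ⟨y, hay, hyD⟩ := Set.not_subset.1 hall
    set U : Set ℝ := {x | a ≤ x ∧ x ∉ D} with hU
    have hUb : BddBelow U := ⟨a, fun x hx => hx.1⟩
    have hUne : U.Nonempty := ⟨y, hay, hyD⟩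
    set b := sInf U with hbdef
    have hab : a ≤ b := le_csInf hUne fun x hx => hx.1
    have hlt : ∀ x, a ≤ x → x < b → x ∈ D := fun x h1 h2 => by
      by_contra hx
      exact (csInf_le hUb (show x ∈ U from ⟨h1, hx⟩)).not_gt h2
    have hbD : b ∈ D := by
      rcases hab.eq_or_lt with h | h
      · rwa [← h]
      · have : b ∈ closure (Set.Ico a b) := by
          rw [closure_Ico h.ne]; exact ⟨hab, le_rfl⟩
        exact hD.closure_subset_iff.2 (fun x hx => hlt x hx.1 hx.2) this
    -- Finiteness of the frontier leaves a gap `(b, c)` without frontier points. The gap contains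
    -- points outside `D`, so by connectedness it misses `D`.
    have hev : ∀ᶠ x in 𝓝[>] b, x ∉ frontier D := by
      have h1 : (frontier D \ {b})ᶜ ∈ 𝓝 b :=
        (hf.subset Set.sdiff_subset).isClosed.isOpen_compl.mem_nhds (by simp)
      filter_upwards [nhdsWithin_le_nhds h1, self_mem_nhdsWithin] with x hx hxb hxf
      exact hx ⟨hxf, (ne_of_gt hxb)⟩
    obtain ⟨c, hbc, hc⟩ := mem_nhdsGT_iff_exists_Ioo_subset.1 hev
    have hbc' : b < c := hbc
    have hdisj : ∀ x ∈ Set.Ioo b c, x ∉ D := by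
      intro x hx hxD
      obtain ⟨z, hz, hzc⟩ := exists_lt_of_csInf_lt hUne (show sInf U < c from hbc)
      have hbz : b < z := lt_of_le_of_ne (csInf_le hUb hz) fun h => hz.2 (h ▸ hbD)
      obtain ⟨w, hw, hwf⟩ := inter_frontier_nonempty_of_isPreconnected
        (isPreconnected_Ioo (a := b) (b := c)) ⟨x, hx, hxD⟩ ⟨z, ⟨hbz, hzc⟩, hz.2⟩
      exact hc hw hwf
    set D' := D ∩ Set.Ici c with hD'
    have hD'c : IsClosed D' := hD.inter isClosed_Ici
    have hsplit : ∀ x, x ∈ D ↔ (a ≤ x ∧ x ≤ b) ∨ x ∈ D' := by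
      intro x
      constructor
      · intro hx
        rcases le_or_gt x b with h | h
        · exact Or.inl ⟨hlow x hx, h⟩
        · exact Or.inr ⟨hx, by by_contra hxc; exact hdisj x ⟨h, not_le.1 hxc⟩ hx⟩
      · rintro (⟨h1, h2⟩ | h)
        · rcases h2.eq_or_lt with rfl | h2
          · exact hbD
          · exact hlt x h1 h2
        · exact h.1
    -- To the right of `b` the sets `D` and `D'` coincide, so every frontier point of `D'` is one of
    -- `D`; it exceeds `b ≥ a`.
    have hfr : frontier D' ⊆ frontier D \ {a} := by
      intro x hx
      have hxD' : x ∈ D' := hD'c.frontier_subset hx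
      have hbx : b < x := hbc'.trans_le hxD'.2
      refine ⟨⟨subset_closure hxD'.1, fun hi => hx.2 ?_⟩, (hab.trans_lt hbx).ne'⟩
      rw [mem_interior_iff_mem_nhds] at hi ⊢
      filter_upwards [hi, Ioi_mem_nhds hbx] with z hz hbz
      exact ((hsplit z).1 hz).resolve_left fun h => h.2.not_gt hbz
    obtain ⟨k, a', b', h⟩ := ih D' hD'c (hb.mono Set.inter_subset_left)
      (hf.subset (hfr.trans Set.sdiff_subset)) (by
        have h1 := Set.ncard_le_ncard hfr (hf.subset Set.sdiff_subset)
        rw [Set.ncard_sdiff_singleton_of_mem haf] at h1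
        omega)
    have hmem : ∀ i, b < a' i := fun i => by
      have : a' i ∈ D' := by
        rw [h.eq]; exact Set.mem_iUnion.2 ⟨i, le_rfl, h.le i⟩
      exact hbc'.trans_le this.2
    refine ⟨k + 1, Fin.cons a a', Fin.cons (b : EReal) b', ?_, ?_, ?_⟩
    · refine Fin.cases ?_ fun i => ?_
      · simpa using hab
      · simpa using h.le i
    · refine Fin.cases ?_ fun i => ?_
      · refine Fin.cases (fun h => absurd h (lt_irrefl _)) fun j _ => ?_
        simpa using hmem j
      · refine Fin.cases (fun h => absurd h (Fin.not_lt_zero _)) fun j hij => ?_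
        simpa using h.lt i j (Fin.succ_lt_succ_iff.1 hij)
    · ext x
      rw [hsplit, h.eq]
      simp only [Set.mem_iUnion, Set.mem_ofPred_eq, Fin.exists_fin_succ, Fin.cons_zero,
        Fin.cons_succ, EReal.coe_le_coe_iff]

lemma exists_isIntervalDecomposition {D : Set ℝ} (hD : IsClosed D) (hb : BddBelow D)
    (hf : (frontier D).Finite) :
    ∃ (k : ℕ) (a : Fin k → ℝ) (b : Fin k → EReal), IsIntervalDecomposition D a b :=
  exists_isIntervalDecomposition_of_ncard_le _ D hD hb hf le_rfl

namespace IsIntervalDecomposition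

variable {D : Set ℝ} {k : ℕ} {a : Fin k → ℝ} {b : Fin k → EReal}

lemma exists_eq_top (h : IsIntervalDecomposition D a b) {M : ℝ} (hM : Set.Ici M ⊆ D) :
    ∃ i, b i = ⊤ := by
  by_contra! hne
  obtain ⟨N, hN⟩ := (Set.finite_range fun i => (b i).toReal).bddAbove
  have hmem : max M (N + 1) ∈ D := hM (Set.mem_Ici.2 (le_max_left _ _))
  rw [h.eq, Set.mem_iUnion] at hmem
  obtain ⟨i, -, hi⟩ := hmem
  have h1 : max M (N + 1) ≤ (b i).toReal := by
    rw [← EReal.coe_le_coe_iff, EReal.coe_toReal (hne i)]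
    · exact hi
    · exact fun hbot => by simp [hbot] at hi
  have h2 : (b i).toReal ≤ N := hN ⟨i, rfl⟩
  have := le_max_right M (N + 1)
  linarith

lemma endPoints_subset (h : IsIntervalDecomposition D a b) : endPoints a b ⊆ D := by
  rintro s ⟨i, hs⟩
  rw [h.eq, Set.mem_iUnion]
  refine ⟨i, ?_⟩
  rcases hs with rfl | hs
  · exact ⟨le_rfl, h.le i⟩
  · exact ⟨by rw [← EReal.coe_le_coe_iff, hs]; exact h.le i, hs.le⟩

lemma mem_interior (h : IsIntervalDecomposition D a b) {s : ℝ} (hs : s ∈ D)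
    (hn : s ∉ endPoints a b) : s ∈ interior D := by
  have hs' := hs
  rw [h.eq, Set.mem_iUnion] at hs'
  obtain ⟨i, h1, h2⟩ := hs'
  have h1' : a i < s := h1.lt_of_ne fun he => hn ⟨i, Or.inl he.symm⟩
  have h2' : (s : EReal) < b i := h2.lt_of_ne fun he => hn ⟨i, Or.inr he⟩
  rw [mem_interior_iff_mem_nhds]
  have h3 : ∀ᶠ x : ℝ in 𝓝 s, (x : EReal) < b i :=
    continuous_coe_real_ereal.continuousAt.eventually (Iio_mem_nhds h2')
  filter_upwards [Ioi_mem_nhds h1', h3] with x hx1 hx2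
  rw [h.eq, Set.mem_iUnion]
  exact ⟨i, (show a i < x from hx1).le, hx2.le⟩

end IsIntervalDecomposition

/-! ### Poincaré polynomials -/

/-- A finite generating set involves only finitely many degrees, and the projection to any other
degree vanishes. This guards against the default value `0` of a `finsum` with infinite support. -/
lemma finite_support_finrank_of_finite_directSum {V : ℕ → Type*} [∀ i, AddCommGroup (V i)]
    [∀ i, Module ℚ (V i)] (h : Module.Finite ℚ (DirectSum ℕ V)) :
    (Function.support fun i => Module.finrank ℚ (V i)).Finite := by
  classical
  obtain ⟨S, hS⟩ := h.fg_top
  refine (S.biUnion fun v => DFinsupp.support v).finite_toSet.subset fun i hi => ?_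
  by_contra hiS
  apply hi
  have hker : (⊤ : Submodule ℚ (DirectSum ℕ V)) ≤ LinearMap.ker (DirectSum.component ℚ ℕ V i) := by
    rw [← hS, Submodule.span_le]
    intro v hv
    by_contra hvi
    exact hiS (Finset.mem_coe.2 (Finset.mem_biUnion.2 ⟨v, hv, DFinsupp.mem_support_iff.2 hvi⟩))
  have : Subsingleton (V i) := subsingleton_of_forall_eq 0 fun w => by
    have := hker (Submodule.mem_top (x := DirectSum.lof ℚ ℕ V i w))
    rwa [LinearMap.mem_ker, DirectSum.component.lof_self] at this
  exact Module.finrank_zero_of_subsingleton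

lemma coeff_finsum_monomial {f g : ℕ → ℕ} (hf : (Function.support f).Finite) (n : ℕ) :
    (∑ᶠ k, monomial (g k) (f k)).coeff n = ∑ᶠ k, (monomial (g k) (f k)).coeff n := by
  have : (Function.support fun k => monomial (g k) (f k)).Finite :=
    hf.subset fun k hk h0 => hk (by simp [h0])
  exact (Polynomial.lcoeff ℕ n).toAddMonoidHom.map_finsum this

lemma finrank_rationalHomology_zero (X : Type u) [TopologicalSpace X] [PathConnectedSpace X] :
    Module.finrank ℚ (rationalHomology X 0) = 1 := by
  have : PathConnectedSpace (TopCat.of X) := ‹_›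
  have e : rationalHomology X 0 ≅ ModuleCat.of ℚ (ULift.{u} ℚ) :=
    CategoryTheory.asIso (TopCat.singularHomology₀ε (TopCat.of X) (ModuleCat.of ℚ (ULift.{u} ℚ)))
  rw [e.toLinearEquiv.finrank_eq]
  exact (ULift.moduleEquiv (R := ℚ) (M := ℚ)).finrank_eq.trans (Module.finrank_self ℚ)

lemma coeff_poincarePoly_zero {X : Type u} [TopologicalSpace X] {x : X}
    (h : IsRationallyElliptic X x) : (poincarePoly X).coeff 0 = 1 := by
  have := h.simplyConnected
  rw [poincarePoly, coeff_finsum_monomial (finite_support_finrank_of_finite_directSum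
    h.finite_homology), finsum_eq_single _ 0 fun k hk => by simp [coeff_monomial, hk]]
  rw [coeff_monomial, if_pos rfl, finrank_rationalHomology_zero]

lemma coeff_homotopyPoincarePoly_zero {X : Type u} [TopologicalSpace X] {x : X}
    (h : IsRationallyElliptic X x) : (homotopyPoincarePoly X x).coeff 0 = 0 := by
  rw [homotopyPoincarePoly, coeff_finsum_monomial (finite_support_finrank_of_finite_directSum
    h.finite_homotopy)]
  simp [coeff_monomial]

/-! ### Finiteness of zero sets -/

/-- Rolle's theorem: a function whose derivative has finitely many zeros on a half line has
finitely many zeros there. -/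
lemma finite_zeros_of_hasDerivAt {f f' : ℝ → ℝ} {a : ℝ} (hf : ∀ x, a ≤ x → HasDerivAt f (f' x) x)
    (h : {x | a ≤ x ∧ f' x = 0}.Finite) : {x | a ≤ x ∧ f x = 0}.Finite := by
  by_contra hinf
  -- With `n` zeros of the derivative, Rolle allows at most `n + 1` zeros of the function, so `n +
  -- 2` are contradictory.
  obtain ⟨S, hS, hcard⟩ := Set.Infinite.exists_subset_card_eq hinf (h.toFinset.card + 2)
  have := Finset.card_le_of_interleaved (s := S) (t := h.toFinset) fun x hx y hy hxy _ => by
    obtain ⟨z, hz, hz0⟩ := exists_hasDerivAt_eq_zero hxy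
      (fun w hw => (hf w ((hS hx).1.trans hw.1)).continuousAt.continuousWithinAt)
      (by rw [(hS hx).2, (hS hy).2]) fun w hw => hf w ((hS hx).1.trans hw.1.le)
    exact ⟨z, by simpa using ⟨(hS hx).1.trans hz.1.le, hz0⟩, hz.1, hz.2⟩
  omega

lemma eq_of_hasDerivAt_zero {f : ℝ → ℝ} {a : ℝ} (hf : ∀ x, a ≤ x → HasDerivAt f 0 x) {x : ℝ}
    (hx : a ≤ x) : f x = f a := by
  rcases hx.eq_or_lt with rfl | hx
  · rfl
  obtain ⟨z, -, hz⟩ := exists_hasDerivAt_eq_slope f (fun _ => 0) hx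
    (fun w hw => (hf w hw.1).continuousAt.continuousWithinAt) fun w hw => hf w hw.1.le
  rw [eq_comm, div_eq_zero_iff] at hz
  rcases hz with hz | hz <;> linarith

lemma finite_zeros_of_eq_eval {f : ℝ → ℝ} {a : ℝ} {w : ℝ[X]} (hw : w ≠ 0)
    (h : ∀ x, a ≤ x → f x = 0 → w.eval x = 0) : {x | a ≤ x ∧ f x = 0}.Finite :=
  (finite_setOfPred_isRoot hw).subset fun x hx => h x hx.1 hx.2

/-! ### Rolle arguments for real polynomials and logarithms -/

section

variable {p q : ℝ[X]} (hp : ∀ s, 1 ≤ s → 0 < p.eval s)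
  (hp' : ∀ s, 1 ≤ s → 0 < (derivative p).eval s) (hq : ∀ s, 1 ≤ s → 1 < q.eval s)
  (hq' : ∀ s, 1 ≤ s → 0 < (derivative q).eval s)

lemma ne_zero_of_eval_pos (h : ∀ s, 1 ≤ s → 0 < p.eval s) : p ≠ 0 := by
  rintro rfl
  simpa using h 1 le_rfl

lemma natDegree_pos_of_derivative_eval_pos (h : ∀ s, 1 ≤ s → 0 < (derivative p).eval s) :
    0 < p.natDegree := by
  rw [Nat.pos_iff_ne_zero, ne_eq, ← derivative_eq_zero]
  exact ne_zero_of_eval_pos h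

include hp' hq hq' in
lemma finite_setOf_eval_eq_const_mul_log (c : ℝ) :
    {s | 1 ≤ s ∧ p.eval s - c * Real.log (q.eval s) = 0}.Finite := by
  have hq0 : ∀ s, 1 ≤ s → 0 < q.eval s := fun s hs => zero_lt_one.trans (hq s hs)
  -- Numerator of the derivative of `p - c log q`. Its first term has degree at least `deg q`, its
  -- second a smaller one.
  have hne : derivative p * q - C c * derivative q ≠ 0 := by
    intro h0
    have h1 := congrArg natDegree (sub_eq_zero.1 h0)
    rw [natDegree_mul (ne_zero_of_eval_pos hp') (ne_zero_of_eval_pos hq0)] at h1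
    have h2 := natDegree_C_mul_le c (derivative q)
    have h3 := natDegree_derivative_lt (natDegree_pos_of_derivative_eval_pos hq').ne'
    omega
  refine finite_zeros_of_hasDerivAt (f' := fun s => (derivative p).eval s -
    c * ((derivative q).eval s / q.eval s))
    (fun s hs => (p.hasDerivAt s).sub (((q.hasDerivAt s).log (hq0 s hs).ne').const_mul c))
    (finite_zeros_of_eq_eval hne fun s hs h => ?_)
  have := (hq0 s hs).ne'
  field_simp at h
  simp only [eval_sub, eval_mul, eval_C]
  linarith

/-- The candidate `P' Q / (P Q')` for the value of the implicit function at a critical point is not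
constant. -/
lemma derivative_div_ne_zero (hp : ∀ s, 1 ≤ s → 0 < p.eval s)
    (hp' : ∀ s, 1 ≤ s → 0 < (derivative p).eval s) (hq : ∀ s, 1 ≤ s → 1 < q.eval s)
    (hq' : ∀ s, 1 ≤ s → 0 < (derivative q).eval s) (hp0 : p.IsRoot 0) (hq0 : ¬ q.IsRoot 0) :
    derivative (derivative p * q) * (p * derivative q) -
      derivative p * q * derivative (p * derivative q) ≠ 0 := by
  set N := derivative p * q with hN
  set M := p * derivative q with hM
  intro h0
  have hq1 : ∀ s, 1 ≤ s → 0 < q.eval s := fun s hs => zero_lt_one.trans (hq s hs)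
  have hMpos : ∀ s, 1 ≤ s → 0 < M.eval s := fun s hs => by
    rw [hM, eval_mul]; exact mul_pos (hp s hs) (hq' s hs)
  have hconst : ∀ s, 1 ≤ s → N.eval s / M.eval s = N.eval 1 / M.eval 1 := by
    intro s hs
    refine eq_of_hasDerivAt_zero (f := fun s => N.eval s / M.eval s) (fun x hx => ?_) hs
    have := (N.hasDerivAt x).div (M.hasDerivAt x) (hMpos x hx).ne'
    rwa [show (derivative N).eval x * M.eval x - N.eval x * (derivative M).eval x = 0 by
      simpa using congrArg (eval x) h0, zero_div] at this
  set c := N.eval 1 / M.eval 1 with hc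
  have hcpos : c ≠ 0 := by
    have : 0 < N.eval 1 := by
      rw [hN, eval_mul]; exact mul_pos (hp' 1 le_rfl) (hq1 1 le_rfl)
    exact (div_pos this (hMpos 1 le_rfl)).ne'
  have hNM : N = C c * M := by
    refine eq_of_infinite_eval_eq _ _ ((Set.Ici_infinite (1 : ℝ)).mono fun s hs => ?_)
    have := hconst s hs
    rw [div_eq_iff (hMpos s hs).ne'] at this
    simpa using this
  have hpne := ne_zero_of_eval_pos hp
  have hqne := ne_zero_of_eval_pos hq1
  have hpne' := ne_zero_of_eval_pos hp'
  have hqne' := ne_zero_of_eval_pos hq'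
  -- At `0`, the order of `p' q` is one less than that of `p`, while the order of `p q'` is at least
  -- that of `p`.
  have h1 := congrArg (rootMultiplicity 0) hNM
  rw [hN, hM, rootMultiplicity_mul (mul_ne_zero hpne' hqne),
    rootMultiplicity_mul (mul_ne_zero (C_ne_zero.2 hcpos) (mul_ne_zero hpne hqne')),
    rootMultiplicity_mul (mul_ne_zero hpne hqne'), rootMultiplicity_C,
    derivative_rootMultiplicity_of_root hp0, rootMultiplicity_eq_zero hq0] at h1
  have := (rootMultiplicity_pos hpne).2 hp0
  omega

include hp hp' hq hq' in
-- With `h = p' q / (p q')` one has `p' / p = h q' / q`, so the derivative of `log h + log p - h log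
-- q` collapses to `h' (1 / h - log q)`. The factor `h'` is a nonzero rational function; the other
-- factor is treated by a second application of Rolle's theorem.
lemma finite_setOf_critical (hp0 : p.IsRoot 0) (hq0 : ¬ q.IsRoot 0) :
    {s | 1 ≤ s ∧ Real.log ((derivative p * q).eval s / (p * derivative q).eval s) +
      Real.log (p.eval s) - (derivative p * q).eval s / (p * derivative q).eval s *
        Real.log (q.eval s) = 0}.Finite := by
  have hW := derivative_div_ne_zero hp hp' hq hq' hp0 hq0
  have hq1 : ∀ s, 1 ≤ s → 0 < q.eval s := fun s hs => zero_lt_one.trans (hq s hs)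
  set N := derivative p * q with hN
  set M := p * derivative q with hM
  set W := derivative N * M - N * derivative M with hWdef
  have hMpos : ∀ s, 1 ≤ s → 0 < M.eval s := fun s hs => by
    rw [hM, eval_mul]; exact mul_pos (hp s hs) (hq' s hs)
  have hNpos : ∀ s, 1 ≤ s → 0 < N.eval s := fun s hs => by
    rw [hN, eval_mul]; exact mul_pos (hp' s hs) (hq1 s hs)
  have hG : ∀ s, 1 ≤ s → HasDerivAt (fun s => M.eval s / N.eval s - Real.log (q.eval s))
      (-(W * q + derivative q * N ^ 2).eval s / (N.eval s ^ 2 * q.eval s)) s := by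
    intro s hs
    refine (((M.hasDerivAt s).div (N.hasDerivAt s) (hNpos s hs).ne').sub
      ((q.hasDerivAt s).log (hq1 s hs).ne')).congr_deriv ?_
    have := (hNpos s hs).ne'
    have := (hq1 s hs).ne'
    rw [hWdef]
    simp only [eval_sub, eval_mul, eval_add, eval_pow]
    field_simp
    ring
  -- Otherwise `M / N - log q` would be constant; but `M` and `N` have equal degree, so `M / N`
  -- converges while `log q` tends to infinity.
  have hV : W * q + derivative q * N ^ 2 ≠ 0 := by
    intro h0
    have hdeg : M.natDegree = N.natDegree := by
      have h1 := natDegree_pos_of_derivative_eval_pos hp'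
      have h2 := natDegree_pos_of_derivative_eval_pos hq'
      rw [hM, hN, natDegree_mul (ne_zero_of_eval_pos hp) (ne_zero_of_eval_pos hq'),
        natDegree_mul (ne_zero_of_eval_pos hp') (ne_zero_of_eval_pos hq1),
        natDegree_derivative, natDegree_derivative]
      omega
    have hlim := div_tendsto_atTop_leadingCoeff_div_of_degree_eq M N (by
      rw [degree_eq_natDegree (ne_zero_of_eval_pos hMpos),
        degree_eq_natDegree (ne_zero_of_eval_pos hNpos), hdeg])
    have hlog : Tendsto (fun s => Real.log (q.eval s)) atTop atTop :=
      Real.tendsto_log_atTop.comp (q.tendsto_atTop_of_leadingCoeff_nonneg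
        (natDegree_pos_iff_degree_pos.1 (natDegree_pos_of_derivative_eval_pos hq')) (by
          by_contra! hneg
          have := q.tendsto_atBot_of_leadingCoeff_nonpos
            (natDegree_pos_iff_degree_pos.1 (natDegree_pos_of_derivative_eval_pos hq')) hneg.le
          obtain ⟨s, hs1, hs2⟩ := ((this.eventually_lt_atBot 0).and (eventually_ge_atTop 1)).exists
          exact (hq1 s hs2).not_gt hs1))
    have hG' := hlim.add_atBot (tendsto_neg_atTop_atBot.comp hlog)
    refine not_tendsto_const_atBot (M.eval 1 / N.eval 1 - Real.log (q.eval 1)) (atTop : Filter ℝ)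
      (hG'.congr' ?_)
    filter_upwards [eventually_ge_atTop 1] with s hs
    rw [← eq_of_hasDerivAt_zero (f := fun s => M.eval s / N.eval s - Real.log (q.eval s))
      (fun x hx => ?_) hs]
    · simp [sub_eq_add_neg]
    · have := hG x hx
      rwa [h0, eval_zero, neg_zero, zero_div] at this
  have hfin1 : {s | 1 ≤ s ∧ M.eval s / N.eval s - Real.log (q.eval s) = 0}.Finite := by
    refine finite_zeros_of_hasDerivAt hG (finite_zeros_of_eq_eval hV fun s hs h => ?_)
    have h1 : N.eval s ^ 2 * q.eval s ≠ 0 :=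
      mul_ne_zero (pow_ne_zero 2 (hNpos s hs).ne') (hq1 s hs).ne'
    rw [div_eq_zero_iff, or_iff_left h1, neg_eq_zero] at h
    exact h
  refine finite_zeros_of_hasDerivAt (f' := fun s => W.eval s / M.eval s ^ 2 *
    (M.eval s / N.eval s - Real.log (q.eval s))) (fun s hs => ?_) ?_
  · have hh := (N.hasDerivAt s).div (M.hasDerivAt s) (hMpos s hs).ne'
    refine (((hh.log (div_pos (hNpos s hs) (hMpos s hs)).ne').add
      ((p.hasDerivAt s).log (hp s hs).ne')).sub
        (hh.mul ((q.hasDerivAt s).log (hq1 s hs).ne'))).congr_deriv ?_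
    have h1 : (derivative p).eval s / p.eval s =
        N.eval s / M.eval s * ((derivative q).eval s / q.eval s) := by
      have := (hp s hs).ne'
      have := (hq1 s hs).ne'
      have := (hq' s hs).ne'
      rw [hN, hM, eval_mul, eval_mul]
      field_simp
    have h2 : (derivative N).eval s * M.eval s - N.eval s * (derivative M).eval s = W.eval s := by
      simp [hWdef]
    simp only [Pi.div_apply]
    rw [h1, h2]
    have := (hMpos s hs).ne'
    have := (hNpos s hs).ne'
    field_simp
    ring
  · refine ((finite_setOfPred_isRoot hW).union hfin1).subset fun s hs => ?_
    rcases mul_eq_zero.1 hs.2 with h | h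
    · rw [div_eq_zero_iff, or_iff_left (pow_ne_zero 2 (hMpos s hs.1).ne')] at h
      exact Or.inl h
    · exact Or.inr ⟨hs.1, h⟩

end

/-! ### Analytic properties of the implicit function -/

/-- With `n = deg p`, `log p(s)` is `n log s` plus `log (p(s) / s ^ n)`, and the latter converges.
-/
lemma tendsto_log_eval_div_log {p : ℝ[X]} (hp : 0 < p.leadingCoeff) :
    Tendsto (fun s => Real.log (p.eval s) / Real.log s) atTop (𝓝 p.natDegree) := by
  have hne : p ≠ 0 := leadingCoeff_ne_zero.1 hp.ne'
  have h1 := div_tendsto_atTop_leadingCoeff_div_of_degree_eq p (X ^ p.natDegree : ℝ[X])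
    (by rw [degree_X_pow, degree_eq_natDegree hne])
  rw [leadingCoeff_X_pow, div_one] at h1
  have h2 := (h1.log hp.ne').div_atTop Real.tendsto_log_atTop
  have h3 := h2.add_const (p.natDegree : ℝ)
  rw [zero_add] at h3
  refine h3.congr' ?_
  filter_upwards [h1.eventually_const_lt hp, eventually_gt_atTop 1] with s hs hs1
  have hs0 : 0 < s := zero_lt_one.trans hs1
  have hlog := (Real.log_pos hs1).ne'
  rw [eval_pow, eval_X] at hs ⊢
  have hsp : 0 < s ^ p.natDegree := by positivity
  have hps : 0 < p.eval s := by
    have := mul_pos hs hsp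
    rwa [div_mul_cancel₀ _ hsp.ne'] at this
  rw [Real.log_div hps.ne' hsp.ne', Real.log_pow]
  field_simp
  ring

section

variable {P Q : ℕ[X]}

lemma leadingCoeff_map_pos (hP : P ≠ 0) : 0 < (P.map (Nat.castRingHom ℝ)).leadingCoeff := by
  rw [leadingCoeff_map_of_injective Nat.cast_injective]
  have : 0 < P.leadingCoeff := Nat.pos_of_ne_zero (leadingCoeff_ne_zero.2 hP)
  simpa using this

lemma natDegree_map_natCast (P : ℕ[X]) :
    (P.map (Nat.castRingHom ℝ)).natDegree = P.natDegree :=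
  natDegree_map_eq_of_injective Nat.cast_injective P

lemma tendsto_log_aeval_div_log (hP : P ≠ 0) :
    Tendsto (fun s : ℝ => Real.log (aeval s P) / Real.log s) atTop (𝓝 P.natDegree) := by
  simpa only [aeval_eq_eval_map, natDegree_map_natCast] using
    tendsto_log_eval_div_log (leadingCoeff_map_pos hP)

lemma continuous_aeval_real (P : ℕ[X]) : Continuous fun s : ℝ => (aeval s P : ℝ) := by
  simp only [aeval_eq_eval_map]
  exact Polynomial.continuous _

lemma hasDerivAt_aeval_real (P : ℕ[X]) (s : ℝ) :
    HasDerivAt (fun s : ℝ => (aeval s P : ℝ)) (aeval s (derivative P)) s := by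
  simp only [aeval_eq_eval_map, ← derivative_map]
  exact Polynomial.hasDerivAt _ s

lemma continuousAt_log_aeval (hQ0 : Q.coeff 0 = 1) (hQ1 : Q ≠ 1) {s : ℝ} (hs : 1 ≤ s) :
    ContinuousAt (fun s : ℝ => Real.log (aeval s Q)) s :=
  (continuous_aeval_real Q).continuousAt.log
    (zero_lt_one.trans (one_lt_aeval hQ0 hQ1 (zero_lt_one.trans_le hs))).ne'

lemma log_aeval_lt_log_aeval (hQ0 : Q.coeff 0 = 1) (hQ1 : Q ≠ 1) {s t : ℝ} (hs : 1 ≤ s)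
    (hst : s < t) : Real.log (aeval s Q) < Real.log (aeval t Q) := by
  refine Real.log_lt_log (zero_lt_one.trans (one_lt_aeval hQ0 hQ1 (zero_lt_one.trans_le hs))) ?_
  obtain ⟨z, hz, hz'⟩ := exists_hasDerivAt_eq_slope _ _ hst
    (continuous_aeval_real Q).continuousOn fun w _ => hasDerivAt_aeval_real Q w
  have := aeval_pos (derivative_ne_zero_of_coeff_zero hQ0 hQ1)
    (zero_lt_one.trans_le (hs.trans hz.1.le))
  rw [hz', lt_div_iff₀ (sub_pos.2 hst)] at this
  linarith

lemma mul_eq_exp_iff_log {p l ρ : ℝ} (hp : 0 < p) (hρ : 0 < ρ) :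
    ρ * p = Real.exp (l * ρ) ↔ Real.log ρ + Real.log p = l * ρ := by
  rw [← Real.log_mul hρ.ne' hp.ne']
  constructor
  · intro h; rw [h, Real.log_exp]
  · intro h; rw [← h, Real.exp_log (mul_pos hρ hp)]

lemma implicitDomain_subset : implicitDomain P Q ⊆ Set.Ici 1 := fun _ hs => hs.1

lemma one_le_of_mem_interior {s : ℝ} (hs : s ∈ interior (implicitDomain P Q)) : 1 ≤ s :=
  implicitDomain_subset (interior_subset hs)

lemma implicitDomain_eq (hP : P ≠ 0) (hQ0 : Q.coeff 0 = 1) (hQ1 : Q ≠ 1) :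
    implicitDomain P Q = {s : ℝ | 1 ≤ s ∧ Real.exp 1 * Real.log (aeval s Q) ≤ aeval s P} := by
  ext s
  refine and_congr_right fun hs => ?_
  have hs0 := zero_lt_one.trans_le hs
  exact solutions_nonempty_iff (aeval_pos hP hs0) (one_lt_aeval hQ0 hQ1 hs0)

lemma exists_implicitFn_eq (hP : P ≠ 0) (hQ0 : Q.coeff 0 = 1) (hQ1 : Q ≠ 1) {s : ℝ}
    (hs : s ∈ implicitDomain P Q) :
    ∃ ρ : ℝ, 0 < ρ ∧ 1 ≤ Real.log (aeval s Q) * ρ ∧ IsGreatest (solutions P Q s) ρ ∧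
      implicitFn P Q s = ρ ∧
      Real.log ρ + Real.log (aeval s P) = Real.log (aeval s Q) * ρ := by
  have hs0 := zero_lt_one.trans_le hs.1
  have hp := aeval_pos hP hs0
  have hq := one_lt_aeval hQ0 hQ1 hs0
  obtain ⟨ρ, h1, hρ⟩ := exists_isGreatest_solutions hp hq hs.2
  have hρ0 : 0 < ρ := pos_of_mul_pos_right (zero_lt_one.trans_le h1) (Real.log_pos hq).le
  refine ⟨ρ, hρ0, h1, hρ, implicitFn_eq_of_isGreatest hρ, ?_⟩
  have := hρ.1
  rw [solutions_eq hq] at this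
  exact (mul_eq_exp_iff_log hp hρ0).1 this

lemma implicitFn_eq_of_log_eq (hP : P ≠ 0) (hQ0 : Q.coeff 0 = 1) (hQ1 : Q ≠ 1) {s ρ : ℝ}
    (hs : 1 ≤ s) (h1 : 1 ≤ Real.log (aeval s Q) * ρ)
    (h : Real.log ρ + Real.log (aeval s P) = Real.log (aeval s Q) * ρ) :
    implicitFn P Q s = ρ := by
  have hs0 := zero_lt_one.trans_le hs
  have hp := aeval_pos hP hs0
  have hq := one_lt_aeval hQ0 hQ1 hs0
  have hρ0 : 0 < ρ := pos_of_mul_pos_right (zero_lt_one.trans_le h1) (Real.log_pos hq).le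
  refine implicitFn_eq_of_isGreatest (isGreatest_solutions hp hq h1 ?_)
  rw [solutions_eq hq]
  exact (mul_eq_exp_iff_log hp hρ0).2 h

/-- At a point of the domain, for real `z > r(s)` the conditions `1 < z log Q` and `z P < Q ^ z` are
open in `s` and together force values below `z`. Off the domain, `P < e log Q` is open and the value
stays `⊥`. Since the function may drop to `⊥` at an end point, only upper semicontinuity is claimed.
-/
lemma upperSemicontinuousOn_implicitFn (hP : P ≠ 0) (hQ0 : Q.coeff 0 = 1) (hQ1 : Q ≠ 1) :
    UpperSemicontinuousOn (implicitFn P Q) (Set.Ici 1) := by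
  intro s hs y hy
  have hs1 : 1 ≤ s := hs
  have hs0 : 0 < s := zero_lt_one.trans_le hs1
  have hp := aeval_pos hP hs0
  have hq := one_lt_aeval hQ0 hQ1 hs0
  have hcP := (continuous_aeval_real P).continuousAt (x := s)
  have hcQ := (continuous_aeval_real Q).continuousAt (x := s)
  have hcl := continuousAt_log_aeval hQ0 hQ1 hs1
  obtain ⟨z, hz1, hz2⟩ := EReal.lt_iff_exists_real_btwn.1 hy
  by_cases hD : s ∈ implicitDomain P Q
  · obtain ⟨ρ, hρ0, h1, hρ, hr, -⟩ := exists_implicitFn_eq hP hQ0 hQ1 hD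
    have hρz : ρ < z := by rwa [hr, EReal.coe_lt_coe_iff] at hz1
    have e1 : ∀ᶠ u : ℝ in 𝓝 s, 1 < Real.log (aeval u Q) * z :=
      (hcl.mul continuousAt_const).eventually_const_lt
        (h1.trans_lt (mul_lt_mul_of_pos_left hρz (Real.log_pos hq)))
    have e2 : ∀ᶠ u : ℝ in 𝓝 s, z * aeval u P < (aeval u Q : ℝ) ^ z :=
      (continuousAt_const.mul hcP).eventually_lt
        (hcQ.rpow_const (Or.inl (zero_lt_one.trans hq).ne'))
        (mul_lt_rpow_of_implicitFn_lt hp.le hq hz1)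
    filter_upwards [nhdsWithin_le_nhds e1, nhdsWithin_le_nhds e2, self_mem_nhdsWithin]
      with u h1 h2 hu
    have hu0 : 0 < u := zero_lt_one.trans_le hu
    exact (implicitFn_lt_of_mul_lt_rpow (aeval_pos hP hu0) (one_lt_aeval hQ0 hQ1 hu0)
      h1.le h2).trans hz2
  · have hlt : (aeval s P : ℝ) < Real.exp 1 * Real.log (aeval s Q) := by
      by_contra! hc
      exact hD ⟨hs1, (solutions_nonempty_iff hp hq).2 hc⟩
    have e1 : ∀ᶠ u : ℝ in 𝓝 s, (aeval u P : ℝ) < Real.exp 1 * Real.log (aeval u Q) :=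
      hcP.eventually_lt (continuousAt_const.mul hcl) hlt
    filter_upwards [nhdsWithin_le_nhds e1, self_mem_nhdsWithin] with u h1 hu
    have hu0 : 0 < u := zero_lt_one.trans_le hu
    rw [implicitFn_eq_bot]
    · exact bot_le.trans_lt hz2
    · rw [solutions_nonempty_iff (aeval_pos hP hu0) (one_lt_aeval hQ0 hQ1 hu0)]
      exact h1.not_ge

lemma natDegree_pos_of_coeff_zero_eq_one (hQ0 : Q.coeff 0 = 1) (hQ1 : Q ≠ 1) :
    0 < Q.natDegree := by
  rw [Nat.pos_iff_ne_zero, ne_eq, ← derivative_eq_zero]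
  exact derivative_ne_zero_of_coeff_zero hQ0 hQ1

lemma natDegree_pos_of_coeff_zero_eq_zero (hP0 : P.coeff 0 = 0) (hP : P ≠ 0) :
    0 < P.natDegree := by
  rw [Nat.pos_iff_ne_zero, ne_eq, ← derivative_eq_zero]
  exact derivative_ne_zero_of_coeff_zero_eq_zero hP0 hP

lemma tendsto_log_aeval_atTop (hQ0 : Q.coeff 0 = 1) (hQ1 : Q ≠ 1) :
    Tendsto (fun s : ℝ => Real.log (aeval s Q)) atTop atTop := by
  have hd : (0 : ℝ) < Q.natDegree := by exact_mod_cast natDegree_pos_of_coeff_zero_eq_one hQ0 hQ1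
  have hQ : Q ≠ 0 := by rintro rfl; simp at hQ0
  refine ((tendsto_log_aeval_div_log hQ).pos_mul_atTop hd Real.tendsto_log_atTop).congr' ?_
  filter_upwards [eventually_gt_atTop 1] with s hs
  exact div_mul_cancel₀ _ (Real.log_pos hs).ne'

/-- For constant `a > 0`, `log (a P / Q ^ a) / log s` tends to `deg P - a deg Q`. Its sign decides,
for large `s`, whether `a` lies below or above the implicit function. -/
lemma tendsto_implicitFn (hP0 : P.coeff 0 = 0) (hP : P ≠ 0) (hQ0 : Q.coeff 0 = 1) (hQ1 : Q ≠ 1) :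
    Tendsto (implicitFn P Q) atTop (𝓝 ((P.natDegree / Q.natDegree : ℝ) : EReal)) := by
  have hQ : Q ≠ 0 := by rintro rfl; simp at hQ0
  have hdQ : (0 : ℝ) < Q.natDegree := by
    exact_mod_cast natDegree_pos_of_coeff_zero_eq_one hQ0 hQ1
  have hdP : (0 : ℝ) < P.natDegree := by
    exact_mod_cast natDegree_pos_of_coeff_zero_eq_zero hP0 hP
  have hlim : ∀ a : ℝ, Tendsto (fun s : ℝ => Real.log a / Real.log s +
      Real.log (aeval s P) / Real.log s - a * (Real.log (aeval s Q) / Real.log s)) atTop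
      (𝓝 (0 + P.natDegree - a * Q.natDegree)) := fun a =>
    ((tendsto_const_nhds.div_atTop Real.tendsto_log_atTop).add
      (tendsto_log_aeval_div_log hP)).sub ((tendsto_log_aeval_div_log hQ).const_mul a)
  have hrw : ∀ a s : ℝ, Real.log a / Real.log s +
      Real.log (aeval s P) / Real.log s - a * (Real.log (aeval s Q) / Real.log s) =
      (Real.log a + Real.log (aeval s P) - Real.log (aeval s Q) * a) / Real.log s := by
    intro a s; ring
  have hexp : ∀ a s : ℝ, 0 < a → 0 < s → a * aeval s P =
      Real.exp (Real.log a + Real.log (aeval s P)) := fun a s ha hs => by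
    rw [Real.exp_add, Real.exp_log ha, Real.exp_log (aeval_pos hP hs)]
  refine tendsto_order.2 ⟨fun y hy => ?_, fun y hy => ?_⟩
  · obtain ⟨z, hz1, hz2⟩ := EReal.lt_iff_exists_real_btwn.1 hy
    rw [EReal.coe_lt_coe_iff] at hz2
    -- The maximum with `0` keeps `a` positive, so that `log a` is meaningful even when the lower
    -- bound is negative.
    obtain ⟨a, ha, hac⟩ := exists_between (max_lt hz2 (div_pos hdP hdQ))
    have ha0 : 0 < a := (le_max_right _ _).trans_lt ha
    have hya : y < a := hz1.trans (EReal.coe_lt_coe_iff.2 ((le_max_left _ _).trans_lt ha))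
    have hpos : 0 < 0 + (P.natDegree : ℝ) - a * Q.natDegree := by
      rw [lt_div_iff₀ hdQ] at hac; linarith
    filter_upwards [(hlim a).eventually_const_lt hpos, eventually_gt_atTop 1] with s hs hs1
    have hs0 : 0 < s := zero_lt_one.trans hs1
    have hq := one_lt_aeval hQ0 hQ1 hs0
    refine hya.trans (lt_implicitFn_of_rpow_lt (aeval_pos hP hs0).le hq ?_)
    rw [hrw, div_pos_iff_of_pos_right (Real.log_pos hs1)] at hs
    rw [Real.rpow_def_of_pos (zero_lt_one.trans hq), hexp a s ha0 hs0]
    exact Real.exp_lt_exp.2 (by linarith)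
  · obtain ⟨a, hz1, hz2⟩ := EReal.lt_iff_exists_real_btwn.1 hy
    rw [EReal.coe_lt_coe_iff] at hz1
    have ha0 : 0 < a := (div_pos hdP hdQ).trans hz1
    have hneg : 0 + (P.natDegree : ℝ) - a * Q.natDegree < 0 := by
      rw [div_lt_iff₀ hdQ] at hz1; linarith
    -- The third condition `1 ≤ a log Q` puts `a` on the increasing branch, where a single
    -- inequality bounds the largest solution.
    filter_upwards [(hlim a).eventually_lt_const hneg, eventually_gt_atTop 1,
      ((tendsto_log_aeval_atTop hQ0 hQ1).atTop_mul_const ha0).eventually_ge_atTop 1]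
      with s hs hs1 hs2
    have hs0 : 0 < s := zero_lt_one.trans hs1
    have hq := one_lt_aeval hQ0 hQ1 hs0
    refine (implicitFn_lt_of_mul_lt_rpow (aeval_pos hP hs0) hq hs2 ?_).trans hz2
    rw [hrw, div_neg_iff, or_iff_right (fun h => h.2.not_gt (Real.log_pos hs1))] at hs
    rw [Real.rpow_def_of_pos (zero_lt_one.trans hq), hexp a s ha0 hs0]
    exact Real.exp_lt_exp.2 (by linarith)

/-- Differentiating `log r + log P = r log Q` where `r' = 0` gives `r = P' Q / (P Q')`. Substituting
this back leaves an equation in `s` alone, with finitely many zeros by `finite_setOf_critical`. -/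
lemma finite_criticalPoints (hP0 : P.coeff 0 = 0) (hP : P ≠ 0) (hQ0 : Q.coeff 0 = 1)
    (hQ1 : Q ≠ 1) : (criticalPoints P Q).Finite := by
  have hP' := derivative_ne_zero_of_coeff_zero_eq_zero hP0 hP
  have hQ' := derivative_ne_zero_of_coeff_zero hQ0 hQ1
  have hfin := finite_setOf_critical (p := P.map (Nat.castRingHom ℝ))
    (q := Q.map (Nat.castRingHom ℝ))
    (fun s hs => by rw [← aeval_eq_eval_map]; exact aeval_pos hP (zero_lt_one.trans_le hs))
    (fun s hs => by
      rw [derivative_map, ← aeval_eq_eval_map]; exact aeval_pos hP' (zero_lt_one.trans_le hs))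
    (fun s hs => by
      rw [← aeval_eq_eval_map]; exact one_lt_aeval hQ0 hQ1 (zero_lt_one.trans_le hs))
    (fun s hs => by
      rw [derivative_map, ← aeval_eq_eval_map]; exact aeval_pos hQ' (zero_lt_one.trans_le hs))
    (by rw [IsRoot.def, ← coeff_zero_eq_eval_zero]; simp [hP0])
    (by rw [IsRoot.def, ← coeff_zero_eq_eval_zero]; simp [hQ0])
  refine hfin.subset fun s hs => ?_
  obtain ⟨hsi, hder⟩ := hs
  have hs1 := one_le_of_mem_interior hsi
  have hs0 := zero_lt_one.trans_le hs1
  refine ⟨hs1, ?_⟩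
  simp only [eval_mul, derivative_map, ← aeval_eq_eval_map]
  have hp := aeval_pos hP hs0
  have hq := zero_lt_one.trans (one_lt_aeval hQ0 hQ1 hs0)
  have hq' := aeval_pos hQ' hs0
  obtain ⟨ρ, hρ0, -, -, hr, hlog⟩ := exists_implicitFn_eq hP hQ0 hQ1 (interior_subset hsi)
  have hrs : (implicitFn P Q s).toReal = ρ := by rw [hr, EReal.toReal_coe]
  have hzero : (fun u : ℝ => Real.log (implicitFn P Q u).toReal + Real.log (aeval u P) -
      Real.log (aeval u Q) * (implicitFn P Q u).toReal) =ᶠ[𝓝 s] fun _ => 0 := by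
    filter_upwards [mem_interior_iff_mem_nhds.1 hsi] with u hu
    obtain ⟨σ, -, -, -, hr, hlog⟩ := exists_implicitFn_eq hP hQ0 hQ1 hu
    rw [hr, EReal.toReal_coe, hlog, sub_self]
  have hd := ((hder.log (by rw [hrs]; exact hρ0.ne')).add
    ((hasDerivAt_aeval_real P s).log hp.ne')).sub
      (((hasDerivAt_aeval_real Q s).log hq.ne').mul hder)
  have h0 := hd.unique ((hasDerivAt_const s (0 : ℝ)).congr_of_eventuallyEq hzero)
  rw [hrs, zero_div, zero_add, mul_zero, add_zero] at h0
  have hρ : (aeval s (derivative P) * aeval s Q : ℝ) / (aeval s P * aeval s (derivative Q)) = ρ := by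
    field_simp at h0 ⊢
    linarith
  rw [hρ, hlog]
  ring

/-- By Fermat's theorem only differentiability is at issue. For `x = r log Q` the equation becomes
`x - log x = log P - log (log Q)`, which can be solved differentiably near any `x > 1`. Maximality
excludes the degenerate value `x = 1`. -/
lemma mem_criticalPoints_of_isMaxOn (hP : P ≠ 0) (hQ0 : Q.coeff 0 = 1) (hQ1 : Q ≠ 1) {s : ℝ}
    (hs : s ∈ interior (implicitDomain P Q)) (hmax : IsMaxOn (implicitFn P Q) (Set.Ici 1) s) :
    s ∈ criticalPoints P Q := by
  have hsD := interior_subset hs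
  have hs1 := one_le_of_mem_interior hs
  have hs0 := zero_lt_one.trans_le hs1
  have hp := aeval_pos hP hs0
  have hq := one_lt_aeval hQ0 hQ1 hs0
  have hl := Real.log_pos hq
  obtain ⟨ρ, hρ0, h1, -, hr, hlog⟩ := exists_implicitFn_eq hP hQ0 hQ1 hsD
  -- at a point with `l ρ = 1` the function takes larger values on the left
  have hne : 1 < Real.log (aeval s Q) * ρ := by
    refine h1.lt_of_ne fun he => ?_
    obtain ⟨u, hu, hus⟩ := nonempty_of_mem (inter_mem (nhdsWithin_le_nhds (s := Set.Iio s)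
      (mem_interior_iff_mem_nhds.1 hs)) self_mem_nhdsWithin)
    obtain ⟨σ, hσ0, hσ1, -, hσr, -⟩ := exists_implicitFn_eq hP hQ0 hQ1 hu
    have hle : implicitFn P Q u ≤ implicitFn P Q s := hmax hu.1
    rw [hr, hσr, EReal.coe_le_coe_iff] at hle
    have h2 := log_aeval_lt_log_aeval hQ0 hQ1 hu.1 hus
    have h3 : Real.log (aeval u Q) * σ < Real.log (aeval s Q) * σ := by gcongr
    have h4 : Real.log (aeval s Q) * σ ≤ Real.log (aeval s Q) * ρ := by gcongr
    linarith
  set x₀ := Real.log (aeval s Q) * ρ with hx₀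
  have hx₀0 : x₀ ≠ 0 := by positivity
  have hφ : HasStrictDerivAt (fun x : ℝ => x - Real.log x) (1 - x₀⁻¹) x₀ :=
    (hasStrictDerivAt_id x₀).sub (Real.hasStrictDerivAt_log hx₀0)
  have hφ' : 1 - x₀⁻¹ ≠ 0 := by
    have := inv_lt_one_of_one_lt₀ hne
    linarith
  set G := hφ.localInverse _ _ _ hφ' with hG
  set y : ℝ → ℝ := fun u => Real.log (aeval u P) - Real.log (Real.log (aeval u Q)) with hy
  have hys : y s = x₀ - Real.log x₀ := by
    rw [hx₀] at hlog
    rw [hx₀, Real.log_mul hl.ne' hρ0.ne', ← hlog]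
    simp only [hy]
    ring
  have hGs : G (y s) = x₀ := by
    rw [hys]; exact hφ.hasStrictFDerivAt_equiv hφ' |>.localInverse_apply_image
  have hGd : HasDerivAt G (1 - x₀⁻¹)⁻¹ (y s) := by
    rw [hys]; exact (hφ.to_localInverse hφ').hasDerivAt
  have hyd : DifferentiableAt ℝ y s :=
    ((hasDerivAt_aeval_real P s).log hp.ne').differentiableAt.sub
      (((hasDerivAt_aeval_real Q s).log (zero_lt_one.trans hq).ne').log hl.ne').differentiableAt
  have hGy : DifferentiableAt ℝ (fun u => G (y u)) s :=
    hGd.differentiableAt.comp s hyd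
  have hR : DifferentiableAt ℝ (fun u : ℝ => G (y u) / Real.log (aeval u Q)) s :=
    hGy.div ((hasDerivAt_aeval_real Q s).log (zero_lt_one.trans hq).ne').differentiableAt hl.ne'
  have e1 : ∀ᶠ u in 𝓝 s, G (y u) - Real.log (G (y u)) = y u := by
    have := hφ.eventually_right_inverse hφ'
    rw [← hys] at this
    exact hyd.continuousAt.eventually this
  -- Staying above `1` ensures that the local inverse yields the largest solution rather than the
  -- one on the decreasing branch.
  have e2 : ∀ᶠ u in 𝓝 s, 1 < G (y u) :=
    hGy.continuousAt.eventually_const_lt (hne.trans_eq hGs.symm)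
  have heq : (fun u : ℝ => (implicitFn P Q u).toReal) =ᶠ[𝓝 s]
      fun u : ℝ => G (y u) / Real.log (aeval u Q) := by
    filter_upwards [e1, e2, mem_interior_iff_mem_nhds.1 hs] with u h1 h2 hu
    have hu0 := zero_lt_one.trans_le hu.1
    have hlu := Real.log_pos (one_lt_aeval hQ0 hQ1 hu0)
    rw [implicitFn_eq_of_log_eq hP hQ0 hQ1 (ρ := G (y u) / Real.log (aeval u Q)) hu.1,
      EReal.toReal_coe]
    · rw [mul_div_cancel₀ _ hlu.ne']; exact h2.le
    · rw [mul_div_cancel₀ _ hlu.ne', Real.log_div (by linarith) hlu.ne']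
      simp only [hy] at h1 ⊢
      linarith
  have hdiff : DifferentiableAt ℝ (fun u : ℝ => (implicitFn P Q u).toReal) s :=
    hR.congr_of_eventuallyEq heq
  have hloc : IsLocalMax (fun u : ℝ => (implicitFn P Q u).toReal) s := by
    filter_upwards [mem_interior_iff_mem_nhds.1 hs] with u hu
    obtain ⟨σ, -, -, -, hσr, -⟩ := exists_implicitFn_eq hP hQ0 hQ1 hu
    have hle : implicitFn P Q u ≤ implicitFn P Q s := hmax hu.1
    rw [hr, hσr] at hle ⊢
    simpa using hle
  have h0 := hloc.hasDerivAt_eq_zero hdiff.hasDerivAt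
  exact ⟨hs, h0 ▸ hdiff.hasDerivAt⟩

end

/-! ### The maximum formula -/

section

variable {P Q : ℕ[X]}

lemma isClosed_implicitDomain (hP : P ≠ 0) (hQ0 : Q.coeff 0 = 1) (hQ1 : Q ≠ 1) :
    IsClosed (implicitDomain P Q) := by
  have hc : ContinuousOn (fun s : ℝ => (aeval s P : ℝ) - Real.exp 1 * Real.log (aeval s Q))
      (Set.Ici 1) := fun s hs =>
    ((continuous_aeval_real P).continuousAt.sub
      (continuousAt_const.mul (continuousAt_log_aeval hQ0 hQ1 hs))).continuousWithinAt
  have := hc.preimage_isClosed_of_isClosed isClosed_Ici (isClosed_Ici (a := (0 : ℝ)))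
  rw [implicitDomain_eq hP hQ0 hQ1]
  convert this using 1
  ext s
  simp

/-- A point `s > 1` with `P(s) > e log Q(s)` is interior, so frontier points are `1` or zeros of `P
- e log Q`. -/
lemma finite_frontier_implicitDomain (hP0 : P.coeff 0 = 0) (hP : P ≠ 0) (hQ0 : Q.coeff 0 = 1)
    (hQ1 : Q ≠ 1) : (frontier (implicitDomain P Q)).Finite := by
  have hP' := derivative_ne_zero_of_coeff_zero_eq_zero hP0 hP
  have hQ' := derivative_ne_zero_of_coeff_zero hQ0 hQ1
  have hfin := finite_setOf_eval_eq_const_mul_log (p := P.map (Nat.castRingHom ℝ))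
    (q := Q.map (Nat.castRingHom ℝ))
    (fun s hs => by
      rw [derivative_map, ← aeval_eq_eval_map]; exact aeval_pos hP' (zero_lt_one.trans_le hs))
    (fun s hs => by
      rw [← aeval_eq_eval_map]; exact one_lt_aeval hQ0 hQ1 (zero_lt_one.trans_le hs))
    (fun s hs => by
      rw [derivative_map, ← aeval_eq_eval_map]; exact aeval_pos hQ' (zero_lt_one.trans_le hs))
    (Real.exp 1)
  simp only [← aeval_eq_eval_map] at hfin
  refine (hfin.union (Set.finite_singleton 1)).subset fun s hs => ?_
  have hsD := (isClosed_implicitDomain hP hQ0 hQ1).frontier_subset hs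
  rw [implicitDomain_eq hP hQ0 hQ1] at hsD
  obtain ⟨hs1, hsg⟩ := hsD
  by_contra hn
  rw [Set.mem_union, not_or] at hn
  have hlt1 : 1 < s := hs1.lt_of_ne fun h => hn.2 h.symm
  have hlt2 : Real.exp 1 * Real.log (aeval s Q) < aeval s P :=
    hsg.lt_of_ne fun h => hn.1 ⟨hs1, sub_eq_zero.2 h.symm⟩
  refine hs.2 (mem_interior_iff_mem_nhds.2 ?_)
  rw [implicitDomain_eq hP hQ0 hQ1]
  filter_upwards [eventually_gt_nhds hlt1,
    (continuousAt_const.mul (continuousAt_log_aeval hQ0 hQ1 hs1)).eventually_lt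
      (continuous_aeval_real P).continuousAt hlt2] with u h1 h2
  exact ⟨h1.le, h2.le⟩

lemma implicitDomain_zero (hQ0 : Q.coeff 0 = 1) (hQ1 : Q ≠ 1) : implicitDomain 0 Q = ∅ := by
  refine Set.eq_empty_of_forall_notMem fun s ⟨hs, ρ, hρ⟩ => ?_
  have hq := one_lt_aeval hQ0 hQ1 (zero_lt_one.trans_le hs)
  rw [solutions, Set.mem_ofPred_eq, map_zero, mul_zero] at hρ
  exact (Real.rpow_pos_of_pos (zero_lt_one.trans hq) ρ).ne hρ

lemma maxFormula_zero (hQ0 : Q.coeff 0 = 1) (hQ1 : Q ≠ 1) : MaxFormula 0 Q (sthReal 0 Q 1) := by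
  have hD := implicitDomain_zero hQ0 hQ1
  have hbot : ∀ s, 1 ≤ s → implicitFn 0 Q s = ⊥ := fun s hs =>
    implicitFn_eq_bot fun hne => by
      have : s ∈ implicitDomain 0 Q := ⟨hs, hne⟩
      simp [hD] at this
  have hcrit : criticalPoints 0 Q = ∅ := by simp [criticalPoints, hD]
  refine ⟨?_, fun s hs => ?_, ?_, 0, Fin.elim0, Fin.elim0, ⊥, ?_, ?_, fun h => absurd rfl h, ?_⟩
  · rw [hD, eq_comm]
    refine Set.eq_empty_of_forall_notMem fun s ⟨hs, h⟩ => ?_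
    rw [map_zero] at h
    exact (mul_pos (Real.exp_pos 1) (Real.log_pos
      (one_lt_aeval hQ0 hQ1 (zero_lt_one.trans_le hs)))).not_ge h
  · simp [hD] at hs
  · simp [hcrit]
  · exact ⟨fun i => i.elim0, fun i => i.elim0, by simp [hD]⟩
  · exact tendsto_const_nhds.congr' ((eventually_ge_atTop 1).mono fun s hs => (hbot s hs).symm)
  · have hτ : sthReal 0 Q 1 = ⊥ := by
      rw [sthReal_eq_iSup hQ0 hQ1 zero_lt_one]
      simp only [iSup_eq_bot]
      exact hbot
    have he : endPoints (Fin.elim0 : Fin 0 → ℝ) (Fin.elim0 : Fin 0 → EReal) = ∅ :=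
      Set.eq_empty_of_forall_notMem fun s ⟨i, _⟩ => i.elim0
    rw [hτ, hcrit, he]
    simp [isGreatest_singleton]

lemma maxFormula_of_ne_zero (hP0 : P.coeff 0 = 0) (hP : P ≠ 0) (hQ0 : Q.coeff 0 = 1)
    (hQ1 : Q ≠ 1) : MaxFormula P Q (sthReal P Q 1) := by
  have hD := implicitDomain_eq hP hQ0 hQ1
  obtain ⟨k, a, b, hab⟩ := exists_isIntervalDecomposition (isClosed_implicitDomain hP hQ0 hQ1)
    ⟨1, fun s hs => hs.1⟩ (finite_frontier_implicitDomain hP0 hP hQ0 hQ1)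
  have hlim := tendsto_implicitFn hP0 hP hQ0 hQ1
  set L : ℝ := P.natDegree / Q.natDegree with hL
  have hnonempty : ∀ {s : ℝ}, 1 ≤ s → implicitFn P Q s ≠ ⊥ → s ∈ implicitDomain P Q :=
    fun hs h => ⟨hs, by_contra fun hne => h (implicitFn_eq_bot hne)⟩
  have hτ := sthReal_eq_iSup (P := P) hQ0 hQ1 zero_lt_one
  have hle : ∀ s, 1 ≤ s → implicitFn P Q s ≤ sthReal P Q 1 := fun s hs => by
    rw [hτ]; exact le_iSup₂ (f := fun s (_ : s ∈ Set.Ici (1 : ℝ)) => implicitFn P Q s) s hs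
  have hLle : (L : EReal) ≤ sthReal P Q 1 :=
    le_of_tendsto hlim ((eventually_ge_atTop 1).mono hle)
  refine ⟨hD, fun s hs => ?_, finite_criticalPoints hP0 hP hQ0 hQ1, k, a, b, L, hab, hlim,
    fun _ => ⟨?_, L, rfl⟩, ?_, ?_⟩
  · obtain ⟨ρ, -, -, h1, h2, -⟩ := exists_implicitFn_eq hP hQ0 hQ1 hs
    exact ⟨ρ, h1, h2⟩
  · obtain ⟨M, hM⟩ := eventually_atTop.1
      ((hlim.eventually_ne (EReal.coe_ne_bot L)).and (eventually_ge_atTop 1))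
    exact hab.exists_eq_top (M := M) fun s hs => hnonempty (hM s hs).2 (hM s hs).1
  -- Either the limit is already the supremum, or some value exceeds it. In the latter case the tail
  -- stays below that value, so the maximum over a compact interval is global.
  · by_cases hall : ∀ s, 1 ≤ s → implicitFn P Q s ≤ L
    · right
      refine (hLle.antisymm ?_).symm
      rw [hτ]
      exact iSup₂_le hall
    · push Not at hall
      obtain ⟨t, ht, hLt⟩ := hall
      obtain ⟨M, hM⟩ := eventually_atTop.1 (hlim.eventually_lt_const hLt)
      obtain ⟨s, hs, hmax⟩ := UpperSemicontinuousOn.exists_isMaxOn (s := Set.Icc 1 (max M t))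
        ⟨t, ht, le_max_right _ _⟩ isCompact_Icc
        ((upperSemicontinuousOn_implicitFn hP hQ0 hQ1).mono Set.Icc_subset_Ici_self)
      have hts : implicitFn P Q t ≤ implicitFn P Q s := hmax ⟨ht, le_max_right _ _⟩
      have hmax' : IsMaxOn (implicitFn P Q) (Set.Ici 1) s := fun u hu => by
        rcases le_total u (max M t) with h | h
        · exact hmax ⟨hu, h⟩
        · exact (hM u ((le_max_left _ _).trans h)).le.trans hts
      have hsD : s ∈ implicitDomain P Q :=
        hnonempty hs.1 (bot_le.trans_lt (hLt.trans_le hts)).ne'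
      have hs' : implicitFn P Q s = sthReal P Q 1 := by
        refine (hle s hs.1).antisymm ?_
        rw [hτ]
        exact iSup₂_le hmax'
      left
      by_cases hend : s ∈ endPoints a b
      · exact Or.inl ⟨s, hend, hs'⟩
      · exact Or.inr ⟨s, mem_criticalPoints_of_isMaxOn hP hQ0 hQ1 (hab.mem_interior hsD hend) hmax',
          hs'⟩
  · rintro _ ((⟨s, hs, rfl⟩ | ⟨s, hs, rfl⟩) | rfl)
    · exact hle s (hab.endPoints_subset hs).1
    · exact hle s (one_le_of_mem_interior hs.1)
    · exact hLle

lemma maxFormula_sthReal (hP0 : P.coeff 0 = 0) (hQ0 : Q.coeff 0 = 1) (hQ1 : Q ≠ 1) :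
    MaxFormula P Q (sthReal P Q 1) := by
  by_cases hP : P = 0
  · subst hP; exact maxFormula_zero hQ0 hQ1
  · exact maxFormula_of_ne_zero hP0 hP hQ0 hQ1

end

end StabThreshold

theorem mainTheorem6 :
    (∀ P Q : Polynomial ℕ, P.coeff 0 = 0 → Q.coeff 0 = 1 → Q ≠ 1 →
      StabThreshold.MaxFormula P Q (StabThreshold.sthReal P Q 1)) ∧
    (∀ (X : Type u) [TopologicalSpace X] (x : X),
      StabThreshold.IsRationallyElliptic X x → StabThreshold.poincarePoly X ≠ 1 →
      StabThreshold.MaxFormula (StabThreshold.homotopyPoincarePoly X x)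
        (StabThreshold.poincarePoly X) (StabThreshold.ppReal X x 1)) := by
  refine ⟨fun P Q => StabThreshold.maxFormula_sthReal, fun X _ x h h1 => ?_⟩
  exact StabThreshold.maxFormula_sthReal (StabThreshold.coeff_homotopyPoincarePoly_zero h)
    (StabThreshold.coeff_poincarePoly_zero h) h1
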